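/- Theorem 5.6. Let $M$ be a matroid on a finite ground set $E$. A cyclic flat of $M$ is a flat of $M$ that is a (possibly empty) union of circuits, and the cyclic width of $M$ is the maximum cardinality of an antichain in the lattice of cyclic flats of $M$ ordered by inclusion. If the cyclic width of $M$ is at most $2$, then $M$ is bitransversal, that is, both $M$ and its dual $M^*$ are transversal matroids. Here a matroid on $E$ is transversal if there is a finite family $(A_1,\dots,A_n)$ of subsets of $E$ such that a set $I\subseteq E$ is independent if and only if $I$ is a partial transversal of the family, i.e. there is an injection $f:I\to\{1,\dots,n\}$ with $x\in A_{f(x)}$ for all $x\in I$. -/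

import Mathlib

namespace Matroid

/-- A cyclic flat of `M`: a flat that is a (possibly empty) union of circuits. -/
def IsCyclicFlat {α : Type*} (M : Matroid α) (F : Set α) : Prop :=
  M.IsFlat F ∧ ∃ S : Set (Set α), (∀ C ∈ S, M.IsCircuit C) ∧ F = ⋃₀ S

/-- The cyclic width of `M`: the width, i.e. the largest cardinality of an antichain, of the
collection of cyclic flats of `M` ordered by inclusion. -/
noncomputable def cyclicWidth {α : Type*} (M : Matroid α) : ℕ∞ :=
  ⨆ (A : Set (Set α)) (_ : (∀ F ∈ A, M.IsCyclicFlat F) ∧ IsAntichain (· ⊆ ·) A), A.encard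

/-- `M` is transversal: there is a finite family `(A i)` of subsets of the ground set
(not necessarily distinct or nonempty) whose partial transversals are exactly the independent
sets of `M`. -/
def IsTransversal {α : Type*} (M : Matroid α) : Prop :=
  ∃ (n : ℕ) (A : Fin n → Set α), (∀ i, A i ⊆ M.E) ∧
    ∀ I : Set α, M.Indep I ↔
      ∃ f : I → Fin n, Function.Injective f ∧ ∀ x : I, (x : α) ∈ A (f x)

/-- `M` is cotransversal: its dual is transversal. -/
def IsCotransversal {α : Type*} (M : Matroid α) : Prop :=
  M✶.IsTransversal

/-- `M` is bitransversal: it is both transversal and cotransversal. -/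
def IsBitransversal {α : Type*} (M : Matroid α) : Prop :=
  M.IsTransversal ∧ M.IsCotransversal

end Matroid

/-! Möbius inversion on the cyclic flats gives weights `β` with total r(E) - r(F) over the cyclic
flats above F. The presentation takes each complement E \ F with multiplicity `β F`, so E \ F meets
X unless X ⊆ F. Hall's condition for independent X then bounds the weight of the upper set {F | X ⊆
F} by r(E) - |X|. Width two makes such an upper set a union of two principal filters, so
inclusion-exclusion and submodularity of rank give the bound; it also gives `β ≥ 0`. A circuit C
meets exactly r(C) < |C| members of the family, so it has no matching. -/

/-- Möbius inversion over principal filters in a finite partial order. -/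
theorem exists_sum_Ici_eq {P : Type*} [PartialOrder P] [Fintype P] [DecidableLE P] (h : P → ℤ) :
    ∃ β : P → ℤ, ∀ x, ∑ y with x ≤ y, β y = h x := by
  classical
  have wf : WellFounded ((· > ·) : P → P → Prop) := wellFounded_gt
  let β : P → ℤ := wf.fix fun x ih ↦ h x - ∑ y : {y // x < y}, ih y.1 y.2
  refine ⟨β, fun x ↦ ?_⟩
  have hβ : β x = h x - ∑ y : {y // x < y}, β y := wf.fix_eq _ x
  have hsub : ∑ y : {y // x < y}, β y = ∑ y with x < y, β y :=
    (Finset.sum_subtype _ (by simp) _).symm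
  have hfilter : (Finset.univ.filter fun y ↦ x ≤ y) =
      insert x (Finset.univ.filter fun y ↦ x < y) := by
    ext y
    simp [le_iff_eq_or_lt, eq_comm]
  rw [hfilter, Finset.sum_insert (by simp), hβ, hsub]
  ring

/-- In a finite partial order of width at most two, a nonempty upper set is the union of two
(possibly equal) principal filters. -/
theorem IsUpperSet.exists_mem_iff_le_or_le {P : Type*} [PartialOrder P] [Finite P]
    (hP : ∀ a b c : P, a ≤ b ∨ b ≤ a ∨ a ≤ c ∨ c ≤ a ∨ b ≤ c ∨ c ≤ b)
    {U : Set P} (hU : IsUpperSet U) (hne : U.Nonempty) :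
    ∃ a ∈ U, ∃ b ∈ U, ∀ x, x ∈ U ↔ a ≤ x ∨ b ≤ x := by
  obtain ⟨a, ha⟩ := U.toFinite.exists_minimal hne
  by_cases hU' : (U \ Set.Ici a).Nonempty
  · obtain ⟨b, hb⟩ := (U \ Set.Ici a).toFinite.exists_minimal hU'
    refine ⟨a, ha.prop, b, hb.prop.1, fun x ↦ ⟨fun hx ↦ ?_, ?_⟩⟩
    · by_contra! hcon
      -- A minimal element outside both filters would form a three-element antichain with `a` and
      -- `b`.
      obtain ⟨c, hc⟩ := (U \ (Set.Ici a ∪ Set.Ici b)).toFinite.exists_minimal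
        ⟨x, hx, by simp [hcon.1, hcon.2]⟩
      have hcU := hc.prop.1
      have hca : ¬ a ≤ c := fun h ↦ hc.prop.2 (.inl h)
      have hcb : ¬ b ≤ c := fun h ↦ hc.prop.2 (.inr h)
      have hab : ¬ a ≤ b := hb.prop.2
      rcases hP a b c with h | h | h | h | h | h
      · exact hab h
      · exact hab (ha.le_of_le hb.prop.1 h)
      · exact hca h
      · exact hca (ha.le_of_le hcU h)
      · exact hcb h
      · exact hcb (hb.le_of_le ⟨hcU, hca⟩ h)
    · rintro (h | h)
      · exact hU h ha.prop
      · exact hU h hb.prop.1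
  · refine ⟨a, ha.prop, a, ha.prop, fun x ↦ ⟨fun hx ↦ ?_, ?_⟩⟩
    · by_contra! hcon
      exact hU' ⟨x, hx, hcon.1⟩
    · rintro (h | h) <;> exact hU h ha.prop

namespace Matroid

variable {α : Type*} {M : Matroid α}

theorem IsCyclicFlat.exists_isCircuit {F : Set α} (hF : M.IsCyclicFlat F) {e : α} (he : e ∈ F) :
    ∃ C, M.IsCircuit C ∧ e ∈ C ∧ C ⊆ F := by
  obtain ⟨-, S, hS, rfl⟩ := hF
  obtain ⟨C, hC, heC⟩ := he
  exact ⟨C, hS C hC, heC, Set.subset_sUnion_of_mem hC⟩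

theorem IsFlat.isCyclicFlat {F : Set α} (hF : M.IsFlat F)
    (h : ∀ e ∈ F, ∃ C, M.IsCircuit C ∧ e ∈ C ∧ C ⊆ F) : M.IsCyclicFlat F := by
  refine ⟨hF, {C | M.IsCircuit C ∧ C ⊆ F}, fun C hC ↦ hC.1, ?_⟩
  refine Set.Subset.antisymm (fun e he ↦ ?_) (Set.sUnion_subset fun C hC ↦ hC.2)
  obtain ⟨C, hC, heC, hCF⟩ := h e he
  exact ⟨C, ⟨hC, hCF⟩, heC⟩

theorem IsFlat.closure_subset_iff_subset {F X : Set α} (hF : M.IsFlat F) (hX : X ⊆ M.E) :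
    M.closure X ⊆ F ↔ X ⊆ F := by
  rw [← hF.closure, M.closure_subset_closure_iff_subset_closure, hF.closure]

/-- The closure of a set that is a union of circuits is a cyclic flat. -/
theorem isCyclicFlat_closure {X : Set α} (hXE : X ⊆ M.E)
    (h : ∀ e ∈ X, ∃ C, M.IsCircuit C ∧ e ∈ C ∧ C ⊆ X) : M.IsCyclicFlat (M.closure X) := by
  have hX := M.subset_closure X hXE
  refine (M.isFlat_closure X).isCyclicFlat fun e he ↦ ?_
  by_cases heX : e ∈ X
  · obtain ⟨C, hC, heC, hCX⟩ := h e heX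
    exact ⟨C, hC, heC, hCX.trans hX⟩
  · obtain ⟨C, hCX, hC, heC⟩ := (mem_closure_iff_exists_isCircuit heX).1 he
    exact ⟨C, hC, heC, hCX.trans (Set.insert_subset he hX)⟩

theorem IsCircuit.isCyclicFlat_closure {C : Set α} (hC : M.IsCircuit C) :
    M.IsCyclicFlat (M.closure C) :=
  Matroid.isCyclicFlat_closure hC.subset_ground fun _ he ↦ ⟨C, hC, he, subset_rfl⟩

theorem IsCyclicFlat.isCyclicFlat_closure_union {F G : Set α} (hF : M.IsCyclicFlat F)
    (hG : M.IsCyclicFlat G) : M.IsCyclicFlat (M.closure (F ∪ G)) := by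
  refine Matroid.isCyclicFlat_closure (Set.union_subset hF.1.subset_ground hG.1.subset_ground) ?_
  rintro e (he | he)
  · obtain ⟨C, hC, heC, hCF⟩ := hF.exists_isCircuit he
    exact ⟨C, hC, heC, hCF.trans Set.subset_union_left⟩
  · obtain ⟨C, hC, heC, hCG⟩ := hG.exists_isCircuit he
    exact ⟨C, hC, heC, hCG.trans Set.subset_union_right⟩

theorem isCyclicFlat_loops (M : Matroid α) : M.IsCyclicFlat M.loops :=
  Matroid.isCyclicFlat_closure (Set.empty_subset _) (by simp)

/-- The complement of a cyclic flat of the dual is a cyclic flat. -/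
theorem IsCyclicFlat.compl_of_dual {F : Set α} (hF : M✶.IsCyclicFlat F) :
    M.IsCyclicFlat (M.E \ F) := by
  have hFE : F ⊆ M.E := hF.1.subset_ground
  have hflat : M.IsFlat (M.E \ F) := by
    rw [isFlat_iff_closure_eq]
    refine Set.Subset.antisymm (fun e he ↦ ?_) (M.subset_closure _ Set.sdiff_subset)
    by_contra hcon
    have heE : e ∈ M.E := M.closure_subset_ground _ he
    have heF : e ∈ F := by_contra fun h ↦ hcon ⟨heE, h⟩
    obtain ⟨K, hK, heK, hKF⟩ := hF.exists_isCircuit heF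
    obtain ⟨C, hCss, hC, heC⟩ := (mem_closure_iff_exists_isCircuit hcon).1 he
    -- `C` lies in (E \ F) ∪ {e} and the cocircuit `K` in F, so they would meet only in `e`.
    refine hC.inter_isCocircuit_ne_singleton hK (e := e)
      (Set.Subset.antisymm (fun x hx ↦ ?_) (Set.singleton_subset_iff.2 ⟨heC, heK⟩))
    obtain rfl | hx' := hCss hx.1
    · rfl
    · exact (hx'.2 (hKF hx.2)).elim
  refine hflat.isCyclicFlat fun e he ↦ ?_
  -- A coloop of M ＼ F is a loop of M✶ ／ F, which cannot exist off F since F is a flat of M✶.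
  have hcoloop : ¬ (M ＼ F).IsColoop e := by
    rw [← dual_isLoop_iff_isColoop, dual_delete, contract_isLoop_iff_mem_closure, hF.1.closure]
    exact fun h ↦ h.2 h.1
  obtain ⟨C, hC, heC⟩ := exists_mem_isCircuit_of_not_isColoop (M := M ＼ F) he hcoloop
  exact ⟨C, hC.of_delete, heC, hC.subset_ground⟩

/-- Among any three cyclic flats, two are comparable. -/
def CyclicWidthLETwo (M : Matroid α) : Prop :=
  ∀ a b c : {F // M.IsCyclicFlat F}, a ≤ b ∨ b ≤ a ∨ a ≤ c ∨ c ≤ a ∨ b ≤ c ∨ c ≤ b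

theorem cyclicWidthLETwo_of_cyclicWidth_le (hM : M.cyclicWidth ≤ 2) : M.CyclicWidthLETwo := by
  rintro ⟨a, ha⟩ ⟨b, hb⟩ ⟨c, hc⟩
  simp only [Subtype.mk_le_mk]
  by_contra! hcon
  obtain ⟨hab, hba, hac, hca, hbc, hcb⟩ := hcon
  have hcard : ({a, b, c} : Set (Set α)).encard = 3 := by
    refine Set.encard_eq_three.2 ⟨a, b, c, ?_, ?_, ?_, rfl⟩
    · rintro rfl; exact hab subset_rfl
    · rintro rfl; exact hac subset_rfl
    · rintro rfl; exact hbc subset_rfl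
  have hle : ({a, b, c} : Set (Set α)).encard ≤ M.cyclicWidth := by
    refine le_iSup₂_of_le _ ⟨?_, ?_⟩ le_rfl
    · rintro F (rfl | rfl | rfl) <;> assumption
    · rintro F (rfl | rfl | rfl) G (rfl | rfl | rfl) hne <;> first | exact (hne rfl).elim | assumption
  rw [hcard] at hle
  exact absurd (hle.trans hM) (by decide)

/-- Complementation in E reverses inclusion and sends cyclic flats of `M✶` to cyclic flats of `M`.
-/
theorem CyclicWidthLETwo.dual (hM : M.CyclicWidthLETwo) : M✶.CyclicWidthLETwo := by
  have key : ∀ a b : {F // M✶.IsCyclicFlat F}, M.E \ a.1 ⊆ M.E \ b.1 → b ≤ a := fun a b h ↦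
    (Set.sdiff_subset_sdiff_iff_subset a.2.1.subset_ground b.2.1.subset_ground).1 h
  intro a b c
  rcases hM ⟨_, a.2.compl_of_dual⟩ ⟨_, b.2.compl_of_dual⟩ ⟨_, c.2.compl_of_dual⟩ with
    h | h | h | h | h | h <;> have := key _ _ h <;> tauto

/-- The rank of a set, as an integer. -/
noncomputable def intRk (M : Matroid α) (X : Set α) : ℤ := (M.eRk X).toNat

theorem coe_intRk [M.RankFinite] (X : Set α) : ((M.eRk X).toNat : ℕ∞) = M.eRk X :=
  ENat.natCast_toNat (eRk_ne_top_iff.2 (M.isRkFinite_set X))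

theorem intRk_mono [M.RankFinite] {X Y : Set α} (h : X ⊆ Y) : M.intRk X ≤ M.intRk Y := by
  have := M.eRk_mono h
  rw [← coe_intRk X, ← coe_intRk Y] at this
  unfold intRk
  exact_mod_cast this

theorem intRk_submod [M.RankFinite] (X Y : Set α) :
    M.intRk (X ∩ Y) + M.intRk (X ∪ Y) ≤ M.intRk X + M.intRk Y := by
  have := M.eRk_submod X Y
  rw [← coe_intRk X, ← coe_intRk Y, ← coe_intRk (X ∩ Y), ← coe_intRk (X ∪ Y)] at this
  unfold intRk
  exact_mod_cast this

theorem intRk_closure (X : Set α) : M.intRk (M.closure X) = M.intRk X := by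
  simp [intRk]

theorem Indep.intRk_eq {I : Set α} (hI : M.Indep I) : M.intRk I = I.ncard := by
  simp [intRk, hI.eRk_eq_encard, Set.ncard]

theorem IsCircuit.intRk_lt [M.Finite] {C : Set α} (hC : M.IsCircuit C) : M.intRk C < C.ncard := by
  have hfin : C.Finite := M.ground_finite.subset hC.subset_ground
  have := hC.eRk_add_one_eq
  rw [← coe_intRk C, ← hfin.cast_ncard_eq] at this
  have : (M.eRk C).toNat + 1 = C.ncard := by exact_mod_cast this
  simp only [intRk]
  omega

open Classical in
/-- In a matroid of cyclic width at most two, the weights `β` of any upper set of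
cyclic flats containing `X` sum to at most the corank of `X`. -/
theorem CyclicWidthLETwo.sum_le [M.RankFinite] [Fintype {F // M.IsCyclicFlat F}]
    (hM : M.CyclicWidthLETwo) {β : {F // M.IsCyclicFlat F} → ℤ}
    (hβ : ∀ F, ∑ G with F ≤ G, β G = M.intRk M.E - M.intRk F)
    {U : Set {F // M.IsCyclicFlat F}} (hU : IsUpperSet U) {X : Set α} (hXE : X ⊆ M.E)
    (hX : ∀ F ∈ U, X ⊆ F) :
    ∑ F with F ∈ U, β F ≤ M.intRk M.E - M.intRk X := by
  obtain rfl | hne := U.eq_empty_or_nonempty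
  · simpa using intRk_mono hXE
  obtain ⟨a, ha, b, hb, hab⟩ := hU.exists_mem_iff_le_or_le hM hne
  let j : {F // M.IsCyclicFlat F} := ⟨_, a.2.isCyclicFlat_closure_union b.2⟩
  have hj : ∀ F, j ≤ F ↔ a ≤ F ∧ b ≤ F := fun F ↦ by
    have : M.closure (a.1 ∪ b.1) ⊆ F.1 ↔ a.1 ∪ b.1 ⊆ F.1 :=
      F.2.1.closure_subset_iff_subset
        (Set.union_subset a.2.1.subset_ground b.2.1.subset_ground)
    exact this.trans Set.union_subset_iff
  -- The two filters meet in the filter of the join `j`, so all three overlapping sums are coranks.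
  have hsum := Finset.sum_union_inter (f := β) (s₁ := Finset.univ.filter fun F ↦ a ≤ F)
    (s₂ := Finset.univ.filter fun F ↦ b ≤ F)
  rw [← Finset.filter_or, ← Finset.filter_and] at hsum
  simp only [← hab, ← hj, hβ] at hsum
  have hrj : M.intRk j.1 = M.intRk (a.1 ∪ b.1) := intRk_closure _
  have := M.intRk_submod a.1 b.1
  have := M.intRk_mono (Set.subset_inter (hX a ha) (hX b hb))
  linarith

theorem isTransversal_of_fintype {ι : Type*} [Fintype ι] (A : ι → Set α) (hA : ∀ i, A i ⊆ M.E)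
    (h : ∀ I : Set α, M.Indep I ↔
      ∃ f : I → ι, Function.Injective f ∧ ∀ x : I, (x : α) ∈ A (f x)) : M.IsTransversal := by
  let e := Fintype.equivFin ι
  refine ⟨Fintype.card ι, A ∘ e.symm, fun i ↦ hA _, fun I ↦ (h I).trans ⟨?_, ?_⟩⟩
  · rintro ⟨f, hf, hfA⟩
    exact ⟨e ∘ f, e.injective.comp hf, by simpa using hfA⟩
  · rintro ⟨f, hf, hfA⟩
    exact ⟨e.symm ∘ f, e.symm.injective.comp hf, hfA⟩

open Classical in
theorem CyclicWidthLETwo.isTransversal [M.Finite] (hM : M.CyclicWidthLETwo) :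
    M.IsTransversal := by
  have hfin : Finite {F // M.IsCyclicFlat F} :=
    (M.ground_finite.finite_subsets.subset fun F hF ↦ hF.1.subset_ground).to_subtype
  have := Fintype.ofFinite {F // M.IsCyclicFlat F}
  obtain ⟨β, hβ⟩ := exists_sum_Ici_eq fun F : {F // M.IsCyclicFlat F} ↦
    M.intRk M.E - M.intRk F
  -- `β F` is the corank of F minus the weight strictly above F.
  have hβ0 : ∀ F, 0 ≤ β F := fun F ↦ by
    have hlt : ∑ G with G ∈ Set.Ioi F, β G ≤ M.intRk M.E - M.intRk F := by
      convert! hM.sum_le hβ (isUpperSet_Ioi F) F.2.1.subset_ground fun G hG ↦ le_of_lt hG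
    have hle := hβ F
    have hfilter : (Finset.univ.filter fun G ↦ F ≤ G) =
        insert F (Finset.univ.filter fun G ↦ G ∈ Set.Ioi F) := by
      ext G
      simp [le_iff_eq_or_lt, eq_comm]
    rw [hfilter, Finset.sum_insert (by simp)] at hle
    linarith
  let ι := Σ F : {F // M.IsCyclicFlat F}, Fin (β F).toNat
  let A : ι → Set α := fun i ↦ M.E \ i.1.1
  have hcard (p : {F // M.IsCyclicFlat F} → Prop) :
      ((Finset.univ.filter fun i : ι ↦ p i.1).card : ℤ) = ∑ F with p F, β F := by
    have hsigma : (Finset.univ.filter fun i : ι ↦ p i.1) =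
        (Finset.univ.filter p).sigma fun F ↦ Finset.univ := by
      ext i
      rw [Finset.mem_filter_univ, Finset.mem_sigma (a := i), Finset.mem_filter_univ]
      exact (and_iff_left (Finset.mem_univ _)).symm
    rw [hsigma, Finset.card_sigma]
    push_cast
    exact Finset.sum_congr rfl fun F _ ↦ by simp [hβ0 F]
  -- The loops form the least cyclic flat, of rank 0.
  have hι : (Fintype.card ι : ℤ) = M.intRk M.E := by
    have h0 := hβ ⟨_, M.isCyclicFlat_loops⟩
    have hbot : ∀ F : {F // M.IsCyclicFlat F}, ⟨_, M.isCyclicFlat_loops⟩ ≤ F := fun F ↦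
      F.2.1.loops_subset
    have hr : M.intRk M.loops = 0 := by simp [intRk]
    have := hcard fun _ ↦ True
    simp only [hbot, hr, sub_zero] at h0
    simp only [Finset.filter_true] at this h0
    rw [← Finset.card_univ, this, h0]
  have hmeet (X : Set α) (hXE : X ⊆ M.E) :
      ((Finset.univ.filter fun i : ι ↦ ∃ x ∈ X, x ∈ A i).card : ℤ) =
        M.intRk M.E - ∑ F : {F // M.IsCyclicFlat F} with X ⊆ F.1, β F := by
    have hnot : (Finset.univ.filter fun i : ι ↦ ∃ x ∈ X, x ∈ A i) =
        Finset.univ.filter fun i : ι ↦ ¬ X ⊆ i.1.1 := by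
      ext i
      simp only [Finset.mem_filter_univ, Set.not_subset]
      exact ⟨fun ⟨x, hx, hxA⟩ ↦ ⟨x, hx, hxA.2⟩, fun ⟨x, hx, hxA⟩ ↦ ⟨x, hx, hXE hx, hxA⟩⟩
    have hadd := Finset.card_filter_add_card_filter_not (s := (Finset.univ : Finset ι))
      fun i : ι ↦ X ⊆ i.1.1
    rw [hnot, ← hcard fun F ↦ X ⊆ F.1, ← hι, ← Finset.card_univ]
    omega
  refine isTransversal_of_fintype A (fun i ↦ Set.sdiff_subset) fun I ↦ ⟨fun hI ↦ ?_, ?_⟩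
  · have hall := (Finset.all_card_le_biUnion_card_iff_exists_injective
      fun x : I ↦ Finset.univ.filter fun i : ι ↦ x.1 ∈ A i).1 fun s ↦ ?_
    · simpa using hall
    · let X : Set α := Subtype.val '' (s : Set I)
      have hXI : M.Indep X := hI.subset (Subtype.coe_image_subset _ _)
      have hXs : X.ncard = s.card := by
        rw [Set.ncard_image_of_injective _ Subtype.val_injective, Set.ncard_coe_finset]
      have hunion : (s.biUnion fun x : I ↦ Finset.univ.filter fun i : ι ↦ x.1 ∈ A i) =
          Finset.univ.filter fun i : ι ↦ ∃ x ∈ X, x ∈ A i := by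
        ext i
        simp [X]
      have hle := hM.sum_le hβ (U := {F | X ⊆ F.1}) (fun F G hFG hF ↦ Set.Subset.trans hF hFG)
        hXI.subset_ground fun F hF ↦ hF
      have hm := hmeet X hXI.subset_ground
      simp only [Set.mem_ofPred_eq] at hle
      rw [hXI.intRk_eq, hXs] at hle
      rw [hunion]
      rw [← Nat.cast_le (α := ℤ), hm]
      linarith
  · rintro ⟨f, hf, hfA⟩
    by_contra hI
    have hIE : I ⊆ M.E := fun x hx ↦ (hfA ⟨x, hx⟩).1
    obtain ⟨C, hCI, hC⟩ := ((not_indep_iff hIE).1 hI).exists_isCircuit_subset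
    let K : {F // M.IsCyclicFlat F} := ⟨_, hC.isCyclicFlat_closure⟩
    have hsub : ∀ F : {F // M.IsCyclicFlat F}, C ⊆ F.1 ↔ K ≤ F := fun F ↦
      (F.2.1.closure_subset_iff_subset hC.subset_ground).symm
    have hm := hmeet C hC.subset_ground
    have hK : M.intRk K.1 = M.intRk C := intRk_closure C
    simp only [hsub, hβ, hK] at hm
    have hlt := hC.intRk_lt
    have hCle : C.ncard ≤ (Finset.univ.filter fun i : ι ↦ ∃ x ∈ C, x ∈ A i).card := by
      have hCfin : Fintype C := (M.ground_finite.subset hC.subset_ground).fintype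
      rw [Set.ncard_eq_toFinset_card', Set.toFinset_card, ← Finset.card_univ]
      refine Finset.card_le_card_of_injOn (fun x : C ↦ f ⟨x, hCI x.2⟩) (fun x _ ↦ ?_) ?_
      · simpa using ⟨x.1, x.2, hfA ⟨x, hCI x.2⟩⟩
      · intro x _ y _ hxy
        exact Subtype.ext (congrArg (fun z : I ↦ z.1) (hf hxy))
    omega

end Matroid

theorem theorem5p6 {α : Type*} (M : Matroid α) [M.Finite] (hM : M.cyclicWidth ≤ 2) :
    M.IsBitransversal := by
  have h := Matroid.cyclicWidthLETwo_of_cyclicWidth_le hM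
  exact ⟨h.isTransversal, h.dual.isTransversal⟩
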